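/- Let $a$ be a positive integer. A permutation of $\{1,\dots,n\}$ is called an $a$-derangement if each of its cycles (fixed points counting as cycles of length $1$) is longer than $a$. Let $d_a(n,k)$ be the number of $a$-derangements of length $n$ with exactly $k$ cycles, and set \[ D_{n,a}(x)=\sum_{k=1}^{\lfloor n/(a+1)\rfloor} d_a(n,k)\,x^k . \] Let $v\neq 1$ be a complex number with $|v|=1$. Then \[ \lim_{n\to\infty}\frac{D_{n,a}(v)}{D_{n,a}(1)}=0 . \] Here, for every $n\ge 1$, $D_{n,a}(1)$ is the number of all $a$-derangements of length $n$; it is nonzero whenever $n>a$, so that the quotient is defined for all $n>a$. -/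

import Mathlib

/-- A permutation of a set of size `n` is an `a`-derangement if each of its cycles is longer
than `a`. The parts of `σ.partition` are the lengths of all cycles of `σ`, the fixed points
being counted as cycles of length one. -/
def IsADerangement (a : ℕ) {n : ℕ} (σ : Equiv.Perm (Fin n)) : Prop :=
  ∀ m ∈ σ.partition.parts, a < m

/-- The number of cycles of a permutation, fixed points included. -/
def numCycles {n : ℕ} (σ : Equiv.Perm (Fin n)) : ℕ :=
  Multiset.card σ.partition.parts

/-- The number of `a`-derangements of length `n`. -/
noncomputable def numADerangements (n a : ℕ) : ℕ :=
  Nat.card {σ : Equiv.Perm (Fin n) // IsADerangement a σ}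

/-- The number `d_a(n,k)` of `a`-derangements of length `n` with `k` cycles. -/
noncomputable def numADerangementsCycles (a n k : ℕ) : ℕ :=
  Nat.card {σ : Equiv.Perm (Fin n) // IsADerangement a σ ∧ numCycles σ = k}

/-- The generating polynomial `D_{n,a}(x) = ∑_{k=1}^{⌊n/(a+1)⌋} d_a(n,k) x^k`. -/
noncomputable def aDerangementPoly (n a : ℕ) : Polynomial ℂ :=
  ∑ k ∈ Finset.Icc 1 (n / (a + 1)),
    Polynomial.C (numADerangementsCycles a n k : ℂ) * Polynomial.X ^ k

/-! Put p_n = D_{n,a}(v)/n!. The generating function of p is exp(v ∑_{i>a} z^i/i), so n p_n = v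
∑_{j<n-a} p_j; here this is proved by counting over partitions (`natCast_mul_partitionSum`). For v =
1 the solution stays above a positive constant. For v ≠ 1 on the unit circle, the partial sums
satisfy S_{n+1} = (1 + v/n) S_n + O(1/n), and |1 + v/n| ≤ 1 + Re v/n + 1/n². Since Re v < 1, S_n =
O(n^s) for some s < 1, hence |p_n| = |S_{n-a}|/n tends to 0. The factor n! cancels in the quotient.
-/

/-! ### Asymptotics of the averaging recurrence. -/

/-- The averaging recurrence with multiplier `v` in the closed unit disc keeps the sequence
bounded by its initial value. -/
theorem norm_le_one_of_average_recurrence {a : ℕ} (ha : 1 ≤ a) {v : ℂ} (hv : ‖v‖ ≤ 1)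
    {p : ℕ → ℂ} (hp0 : p 0 = 1)
    (hp : ∀ n : ℕ, n * p n = v * ∑ j ∈ Finset.range (n - a), p j) (n : ℕ) : ‖p n‖ ≤ 1 := by
  induction n using Nat.strong_induction_on with
  | _ n ih =>
    rcases Nat.eq_zero_or_pos n with rfl | hn
    · simp [hp0]
    · have hn' : (0 : ℝ) < n := by exact_mod_cast hn
      have h1 : (n : ℝ) * ‖p n‖ = ‖v‖ * ‖∑ j ∈ Finset.range (n - a), p j‖ := by
        rw [← norm_mul, ← hp n, norm_mul, Complex.norm_natCast]
      have h2 : ‖∑ j ∈ Finset.range (n - a), p j‖ ≤ n := by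
        calc _ ≤ ∑ j ∈ Finset.range (n - a), (1 : ℝ) :=
              norm_sum_le_of_le _ fun j hj => ih j (by have := Finset.mem_range.1 hj; omega)
          _ = ((n - a : ℕ) : ℝ) := by simp
          _ ≤ n := by exact_mod_cast Nat.sub_le n a
      have h3 : (n : ℝ) * ‖p n‖ ≤ n * 1 := by
        rw [h1, mul_one]
        exact (mul_le_of_le_one_left (norm_nonneg _) hv).trans h2
      exact le_of_mul_le_mul_left h3 hn'

/-- With multiplier `1`, the averaging recurrence expresses each term as a convex combination of
two earlier ones, so that its solution is bounded away from zero. -/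
theorem exists_pos_le_of_average_recurrence {a : ℕ} (ha : 1 ≤ a) {r : ℕ → ℝ} (hr0 : r 0 = 1)
    (hr : ∀ n : ℕ, n * r n = ∑ j ∈ Finset.range (n - a), r j) :
    ∃ c > 0, ∀ n, a < n → c ≤ r n := by
  have hnonneg : ∀ n, 0 ≤ r n := by
    intro n
    induction n using Nat.strong_induction_on with
    | _ n ih =>
      rcases Nat.eq_zero_or_pos n with rfl | hn
      · simp [hr0]
      · have hn' : (0 : ℝ) < n := by exact_mod_cast hn
        have : 0 ≤ (n : ℝ) * r n := by
          rw [hr n]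
          exact Finset.sum_nonneg fun j hj => ih j (by have := Finset.mem_range.1 hj; omega)
        exact nonneg_of_mul_nonneg_right this hn'
  -- For a < n ≤ 2a+1 the term r 0 = 1 alone gives n r_n ≥ 1. Beyond that, both n-1 and n-1-a exceed
  -- a, so induction applies to them.
  refine ⟨1 / (2 * a + 1), by positivity, fun n => ?_⟩
  induction n using Nat.strong_induction_on with
  | _ n ih =>
    intro hn
    have hn' : (0 : ℝ) < n := by exact_mod_cast (by omega : 0 < n)
    rcases Nat.lt_or_ge n (2 * a + 2) with h | h
    · have h1 : 1 ≤ (n : ℝ) * r n := by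
        rw [hr n, ← hr0]
        exact Finset.single_le_sum (f := r) (fun j _ => hnonneg j)
          (Finset.mem_range.2 (by omega))
      have h2 : (n : ℝ) ≤ 2 * a + 1 := by exact_mod_cast (by omega : n ≤ 2 * a + 1)
      rw [div_le_iff₀ (by positivity)]
      nlinarith [hnonneg n]
    · obtain ⟨m, rfl⟩ : ∃ m, n = m + 1 := ⟨n - 1, by omega⟩
      have h1 := hr (m + 1)
      have h2 := hr m
      -- Subtracting consecutive recurrences: (m+1) r_{m+1} = m r_m + r_{m-a}.
      rw [show m + 1 - a = (m - a) + 1 by omega, Finset.sum_range_succ, ← h2] at h1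
      have h3 := ih m (by omega) (by omega)
      have h4 := ih (m - a) (by omega) (by omega)
      push_cast at h1 hn'
      have hm : (0 : ℝ) ≤ m := Nat.cast_nonneg m
      have h5 := mul_le_mul_of_nonneg_left h3 hm
      refine le_of_mul_le_mul_left ?_ hn'
      rw [h1]
      linarith

/-- With x = 1/n, the square of the right side exceeds |1 + vx|² = 1 + 2x Re v + x² by x²(1 + (Re v
+ x)²). -/
theorem norm_one_add_div_natCast_le {v : ℂ} (hv : ‖v‖ = 1) {n : ℕ} (hn : 1 ≤ n) :
    ‖1 + v / n‖ ≤ 1 + v.re / n + 1 / (n : ℝ) ^ 2 := by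
  have hn' : (1 : ℝ) ≤ n := by exact_mod_cast hn
  have hre : |v.re| ≤ 1 := hv ▸ Complex.abs_re_le_norm v
  have hsq : v.re * v.re + v.im * v.im = 1 := by
    have := Complex.normSq_eq_norm_sq v
    rw [hv, Complex.normSq_apply] at this
    simpa using this
  have hx : 0 < 1 / (n : ℝ) := by positivity
  have hx1 : 1 / (n : ℝ) ≤ 1 := by rw [div_le_one (by positivity)]; exact hn'
  have hE : 1 + v.re / n + 1 / (n : ℝ) ^ 2 = 1 + v.re * (1 / n) + (1 / n) ^ 2 := by ring
  have hV : 1 + v / n = 1 + ((1 / n : ℝ) : ℂ) * v := by push_cast; ring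
  rw [hE, hV]
  generalize 1 / (n : ℝ) = x at hx hx1
  have ⟨hl, hu⟩ := abs_le.1 hre
  refine le_of_sq_le_sq ?_ (by nlinarith)
  rw [← Complex.normSq_eq_norm_sq, Complex.normSq_apply]
  simp only [Complex.add_re, Complex.one_re, Complex.re_ofReal_mul, Complex.add_im,
    Complex.one_im, Complex.im_ofReal_mul]
  have h1 : 0 ≤ x ^ 2 * (1 + 2 * v.re * x + v.re ^ 2 + x ^ 2) := by
    refine mul_nonneg (sq_nonneg x) ?_
    nlinarith [sq_nonneg (v.re + x)]
  have h2 : (1 + x * v.re) * (1 + x * v.re) + (0 + x * v.im) * (0 + x * v.im)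
      = 1 + 2 * x * v.re + x ^ 2 := by linear_combination x ^ 2 * hsq
  rw [h2]
  nlinarith

/-- A discrete Grönwall inequality. -/
theorem le_mul_rpow_of_le_one_add_div_mul {U : ℕ → ℝ} {s : ℝ} (hs0 : 0 ≤ s) (hs1 : s ≤ 1)
    (hU0 : ∀ n, 0 ≤ U n) (hU : ∀ n : ℕ, 1 ≤ n → U (n + 1) ≤ (1 + s / n) * U n) (n : ℕ)
    (hn : 1 ≤ n) : U (n + 1) ≤ U 2 * (n : ℝ) ^ s := by
  induction n, hn using Nat.le_induction with
  | base => simp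
  | succ n hn ih =>
    have hn' : (0 : ℝ) < n := by exact_mod_cast hn
    have hx1 : (1 : ℝ) / (n + 1) ≤ 1 := by rw [div_le_one (by positivity)]; linarith
    -- Bernoulli for exponents in [0,1] bounds (n/(n+1))^s by 1 - s/(n+1); then (1+y)(1-y) ≤ 1
    -- closes the induction.
    have hB := rpow_one_add_le_one_add_mul_self (s := -(1 / ((n : ℝ) + 1))) (by linarith)
      hs0 hs1
    have hq : (n : ℝ) = (1 + -(1 / ((n : ℝ) + 1))) * (n + 1) := by field_simp; ring
    have hpow : (n : ℝ) ^ s ≤ (1 - s / (n + 1)) * ((n : ℝ) + 1) ^ s := by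
      conv_lhs => rw [hq]
      rw [Real.mul_rpow (by linarith) (by positivity)]
      refine mul_le_mul_of_nonneg_right (hB.trans_eq (by ring)) (by positivity)
    have h1 := hU (n + 1) (by omega)
    push_cast at h1 ⊢
    have hy : 0 ≤ s / ((n : ℝ) + 1) := by positivity
    calc U (n + 1 + 1) ≤ (1 + s / (n + 1)) * U (n + 1) := h1
      _ ≤ (1 + s / (n + 1)) * (U 2 * ((1 - s / (n + 1)) * ((n : ℝ) + 1) ^ s)) := by
        refine mul_le_mul_of_nonneg_left (ih.trans ?_) (by positivity)
        exact mul_le_mul_of_nonneg_left hpow (hU0 2)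
      _ = (1 - (s / (n + 1)) ^ 2) * (U 2 * ((n : ℝ) + 1) ^ s) := by ring
      _ ≤ U 2 * ((n : ℝ) + 1) ^ s := by
        refine mul_le_of_le_one_left (mul_nonneg (hU0 2) (by positivity)) ?_
        nlinarith

open Filter Topology in
/-- With a multiplier `v ≠ 1` on the unit circle, the solution of the averaging recurrence tends
to zero. -/
theorem tendsto_zero_of_average_recurrence {a : ℕ} (ha : 1 ≤ a) {v : ℂ} (hv : v ≠ 1)
    (hv' : ‖v‖ = 1) {p : ℕ → ℂ} (hp0 : p 0 = 1)
    (hp : ∀ n : ℕ, n * p n = v * ∑ j ∈ Finset.range (n - a), p j) :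
    Tendsto p atTop (𝓝 0) := by
  have hb := norm_le_one_of_average_recurrence ha hv'.le hp0 hp
  have hre : v.re < 1 := by
    refine lt_of_le_of_ne (hv' ▸ Complex.re_le_norm v) fun h => hv ?_
    have := Complex.normSq_eq_norm_sq v
    rw [hv', Complex.normSq_apply, h] at this
    exact Complex.ext h (by simpa using this)
  set S : ℕ → ℂ := fun n => ∑ j ∈ Finset.range n, p j with hS
  have hSn : ∀ n, ‖S n‖ ≤ n := fun n =>
    (norm_sum_le_of_le _ fun j _ => hb j).trans_eq (by simp)
  have hdiff : ∀ n, ‖S (n - a) - S n‖ ≤ a := by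
    intro n
    rw [norm_sub_rev, hS, ← Finset.sum_Ico_eq_sub _ (Nat.sub_le n a)]
    refine (norm_sum_le_of_le _ fun j _ => hb j).trans ?_
    simp only [Finset.sum_const, Nat.card_Ico, nsmul_eq_mul, mul_one]
    exact_mod_cast (by omega : n - (n - a) ≤ a)
  -- Re v may be negative or zero; the 1/2 keeps s positive, so that one can divide by s below.
  set s : ℝ := max v.re (1 / 2) with hs
  have hs0 : 0 < s := lt_of_lt_of_le (by norm_num) (le_max_right _ _)
  have hs1 : s < 1 := max_lt hre (by norm_num)
  have hstep : ∀ n : ℕ, 1 ≤ n → ‖S (n + 1)‖ ≤ (1 + s / n) * ‖S n‖ + (a + 1) / n := by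
    intro n hn
    have hn' : (0 : ℝ) < n := by exact_mod_cast hn
    have hnC : (n : ℂ) ≠ 0 := by exact_mod_cast hn'.ne'
    have hpn : p n = v / n * S (n - a) := by
      have := hp n
      field_simp
      linear_combination this
    have hSs : S (n + 1) = (1 + v / n) * S n + v / n * (S (n - a) - S n) := by
      have : S (n + 1) = S n + p n := Finset.sum_range_succ _ _
      rw [this, hpn]
      ring
    have h1 : ‖1 + v / n‖ ≤ 1 + s / n + 1 / (n : ℝ) ^ 2 := by
      refine (norm_one_add_div_natCast_le hv' hn).trans ?_
      have := div_le_div_of_nonneg_right (le_max_left v.re (1 / 2)) hn'.le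
      linarith
    have h2 : ‖v / n * (S (n - a) - S n)‖ ≤ a / n := by
      rw [norm_mul, norm_div, hv', Complex.norm_natCast, one_div_mul_eq_div]
      exact div_le_div_of_nonneg_right (hdiff n) hn'.le
    calc ‖S (n + 1)‖ ≤ ‖1 + v / n‖ * ‖S n‖ + ‖v / n * (S (n - a) - S n)‖ := by
          rw [hSs, ← norm_mul]; exact norm_add_le _ _
      _ ≤ (1 + s / n + 1 / (n : ℝ) ^ 2) * ‖S n‖ + a / n :=
          add_le_add (mul_le_mul_of_nonneg_right h1 (norm_nonneg _)) h2
      _ = (1 + s / n) * ‖S n‖ + (1 / (n : ℝ) ^ 2 * ‖S n‖ + a / n) := by ring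
      -- The trivial bound |S_n| ≤ n turns the 1/n² error into one of order 1/n.
      _ ≤ (1 + s / n) * ‖S n‖ + (1 / (n : ℝ) ^ 2 * n + a / n) := by
          gcongr; exact hSn n
      _ = _ := by field_simp; ring
  -- The shift absorbs the inhomogeneous term, as (s/n)·(a+1)/s = (a+1)/n.
  set U : ℕ → ℝ := fun n => ‖S n‖ + (a + 1) / s with hUdef
  have hU0 : ∀ n, 0 ≤ U n := fun n => by positivity
  have hU : ∀ n : ℕ, 1 ≤ n → U (n + 1) ≤ (1 + s / n) * U n := by
    intro n hn
    have hn' : (0 : ℝ) < n := by exact_mod_cast hn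
    have : (1 + s / n) * U n = (1 + s / n) * ‖S n‖ + (a + 1) / n + (a + 1) / s := by
      simp only [hUdef]; field_simp; ring
    rw [this]
    simp only [hUdef]
    linarith [hstep n hn]
  have hmain := le_mul_rpow_of_le_one_add_div_mul hs0.le hs1.le hU0 hU
  have hbound : ∀ n : ℕ, 1 ≤ n →
      ‖p n‖ ≤ U 2 * (n : ℝ) ^ (-(1 - s)) + (a + 1) * (n : ℝ)⁻¹ := by
    intro n hn
    have hn' : (0 : ℝ) < n := by exact_mod_cast hn
    have h1 : (n : ℝ) * ‖p n‖ = ‖S (n - a)‖ := by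
      have := congrArg norm (hp n)
      rwa [norm_mul, norm_mul, hv', Complex.norm_natCast, one_mul] at this
    have h2 : ‖S (n - a)‖ ≤ ‖S (n + 1)‖ + (a + 1) := by
      have e : S (n - a) = S (n + 1) - p n + (S (n - a) - S n) := by
        have : S (n + 1) = S n + p n := Finset.sum_range_succ _ _
        rw [this]; ring
      rw [e]
      have := norm_add_le (S (n + 1) - p n) (S (n - a) - S n)
      have := norm_sub_le (S (n + 1)) (p n)
      linarith [hb n, hdiff n]
    have h3 : ‖S (n + 1)‖ ≤ U 2 * (n : ℝ) ^ s :=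
      (le_add_of_nonneg_right (by positivity)).trans (hmain n hn)
    have h4 : (n : ℝ) ^ (-(1 - s)) = (n : ℝ) ^ s / n := by
      rw [show -(1 - s) = s - 1 by ring, Real.rpow_sub_one hn'.ne']
    rw [h4]
    have h5 : U 2 * ((n : ℝ) ^ s / n) + (a + 1) * (n : ℝ)⁻¹
        = (U 2 * (n : ℝ) ^ s + (a + 1)) / n := by ring
    rw [h5, le_div_iff₀ hn', mul_comm, h1]
    linarith
  refine squeeze_zero_norm' (Filter.eventually_atTop.2 ⟨1, hbound⟩) ?_
  have t1 := ((tendsto_rpow_neg_atTop (sub_pos.2 hs1)).comp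
    tendsto_natCast_atTop_atTop).const_mul (U 2)
  have t2 := (tendsto_inv_atTop_nhds_zero_nat (𝕜 := ℝ)).const_mul ((a : ℝ) + 1)
  simpa using t1.add t2

/-! ### Weighted partitions and their recurrence. -/

/-- The number of permutations with cycle lengths `m`, divided by the number of all permutations,
times `v` to the number of cycles. -/
noncomputable def cycleWeight (v : ℂ) (m : Multiset ℕ) : ℂ :=
  v ^ Multiset.card m / (m.prod * ∏ i ∈ m.toFinset, ((m.count i).factorial : ℂ))

theorem prod_factorial_count_cons (i : ℕ) (m : Multiset ℕ) :
    ∏ j ∈ (i ::ₘ m).toFinset, (((i ::ₘ m).count j).factorial : ℂ) =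
      (m.count i + 1) * ∏ j ∈ m.toFinset, ((m.count j).factorial : ℂ) := by
  have h : ∏ j ∈ m.toFinset, ((m.count j).factorial : ℂ)
      = ∏ j ∈ insert i m.toFinset, ((m.count j).factorial : ℂ) := by
    refine Finset.prod_subset (Finset.subset_insert _ _) fun j _ hj => ?_
    rw [Multiset.count_eq_zero_of_notMem (fun h => hj (Multiset.mem_toFinset.2 h))]
    simp
  rw [h, Multiset.toFinset_cons, ← Finset.mul_prod_erase _ _ (Finset.mem_insert_self i _),
    ← Finset.mul_prod_erase _ _ (Finset.mem_insert_self i m.toFinset), ← mul_assoc]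
  congr 1
  · simp [Nat.factorial_succ]
  · refine Finset.prod_congr rfl fun j hj => ?_
    rw [Multiset.count_cons_of_ne (Finset.ne_of_mem_erase hj)]

theorem mul_cycleWeight_cons (v : ℂ) {i : ℕ} (hi : 0 < i) (m : Multiset ℕ) :
    i * ((i ::ₘ m).count i : ℂ) * cycleWeight v (i ::ₘ m) = v * cycleWeight v m := by
  have h1 : (i : ℂ) ≠ 0 := by exact_mod_cast hi.ne'
  have h2 : (m.count i + 1 : ℂ) ≠ 0 := Nat.cast_add_one_ne_zero _
  simp only [cycleWeight]
  rw [prod_factorial_count_cons, Multiset.card_cons, Multiset.prod_cons, Multiset.count_cons_self,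
    Nat.cast_mul, Nat.cast_add_one, pow_succ, mul_div_assoc', mul_div_assoc',
    show (i : ℂ) * (m.count i + 1) * (v ^ Multiset.card m * v)
      = (i * (m.count i + 1)) * (v * v ^ Multiset.card m) by ring,
    show (i : ℂ) * (m.prod : ℂ) * ((m.count i + 1) *
        ∏ j ∈ m.toFinset, ((m.count j).factorial : ℂ))
      = (i * (m.count i + 1)) * (m.prod * ∏ j ∈ m.toFinset, ((m.count j).factorial : ℂ)) by ring,
    mul_div_mul_left _ _ (mul_ne_zero h1 h2)]

/-- The partitions of `n` with all parts larger than `a`. -/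
def largePartitions (a n : ℕ) : Finset n.Partition :=
  Finset.univ.filter fun p => ∀ m ∈ p.parts, a < m

/-- The `n`-th coefficient of the exponential generating function of the `a`-derangement
polynomials, as a sum over partitions. -/
noncomputable def partitionSum (v : ℂ) (a n : ℕ) : ℂ :=
  ∑ p ∈ largePartitions a n, cycleWeight v p.parts

theorem partitionSum_zero (v : ℂ) (a : ℕ) : partitionSum v a 0 = 1 := by
  simp [partitionSum, largePartitions, cycleWeight]

/-- Erasing one copy of i is a bijection onto the large partitions of n - i, and it divides the
denominator of the weight by i times the multiplicity of i. -/
theorem sum_cycleWeight_of_mem (v : ℂ) {a n i : ℕ} (hai : a < i) (hin : i ≤ n) :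
    ∑ p ∈ largePartitions a n with i ∈ p.parts,
      i * (p.parts.count i : ℂ) * cycleWeight v p.parts = v * partitionSum v a (n - i) := by
  rw [partitionSum, Finset.mul_sum]
  refine Finset.sum_bij'
    (i := fun p hp => ⟨p.parts.erase i, fun h => p.parts_pos (Multiset.mem_of_mem_erase h), by
      have h := (Finset.mem_filter.1 hp).2
      have := congrArg Multiset.sum (Multiset.cons_erase h)
      rw [Multiset.sum_cons, p.parts_sum] at this
      omega⟩)
    (j := fun q _ => ⟨i ::ₘ q.parts, fun {j} h => by
      rcases Multiset.mem_cons.1 h with rfl | h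
      · omega
      · exact q.parts_pos h, by rw [Multiset.sum_cons, q.parts_sum]; omega⟩) ?_ ?_ ?_ ?_ ?_
  · intro p hp
    simp only [largePartitions, Finset.mem_filter, Finset.mem_univ, true_and] at hp ⊢
    exact fun m hm => hp.1 m (Multiset.mem_of_mem_erase hm)
  · intro q hq
    simp only [largePartitions, Finset.mem_filter, Finset.mem_univ, true_and] at hq ⊢
    refine ⟨fun m hm => ?_, Multiset.mem_cons_self _ _⟩
    rcases Multiset.mem_cons.1 hm with rfl | h
    · exact hai
    · exact hq m h
  · intro p hp
    exact Nat.Partition.ext (Multiset.cons_erase (Finset.mem_filter.1 hp).2)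
  · intro q hq
    exact Nat.Partition.ext (Multiset.erase_cons_head _ _)
  · intro p hp
    have h := mul_cycleWeight_cons v (by omega : 0 < i) (p.parts.erase i)
    rwa [Multiset.cons_erase (Finset.mem_filter.1 hp).2] at h

/-- Write n as the sum of i · count i over the distinct parts i, then exchange the sums over
partitions and parts. -/
theorem natCast_mul_partitionSum (v : ℂ) (a n : ℕ) :
    n * partitionSum v a n = v * ∑ j ∈ Finset.range (n - a), partitionSum v a j := by
  have h1 : ∀ p ∈ largePartitions a n, n * cycleWeight v p.parts
      = ∑ i ∈ p.parts.toFinset, i * (p.parts.count i : ℂ) * cycleWeight v p.parts := by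
    intro p _
    rw [← Finset.sum_mul]
    congr 1
    have := Finset.sum_multiset_count p.parts
    rw [p.parts_sum] at this
    conv_lhs => rw [this]
    push_cast [smul_eq_mul]
    exact Finset.sum_congr rfl fun i _ => mul_comm _ _
  rw [partitionSum, Finset.mul_sum, Finset.sum_congr rfl h1,
    Finset.sum_comm' (t' := Finset.Ioc a n)
      (s' := fun i => (largePartitions a n).filter fun p => i ∈ p.parts)]
  · rw [Finset.sum_congr rfl fun i hi => sum_cycleWeight_of_mem v (Finset.mem_Ioc.1 hi).1
      (Finset.mem_Ioc.1 hi).2, ← Finset.mul_sum]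
    congr 1
    refine Finset.sum_nbij' (fun i => n - i) (fun j => n - j) ?_ ?_ ?_ ?_ ?_ <;>
      intro i hi <;> simp only [Finset.mem_Ioc, Finset.mem_range] at hi ⊢ <;> omega
  · intro p i
    simp only [Finset.mem_filter, Multiset.mem_toFinset, Finset.mem_Ioc]
    constructor
    · rintro ⟨h, h'⟩
      exact ⟨⟨h, h'⟩, (Finset.mem_filter.1 h).2 i h', Nat.Partition.le_of_mem_parts h'⟩
    · rintro ⟨h, _⟩
      exact h

/-! ### From partitions to permutations. -/

-- `cycleType` omits fixed points, but parts of size at least 2 exclude them, so Cauchy's count by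
-- cycle type applies with no leftover factor.
open Finset in
theorem card_partition_eq {α : Type*} [Fintype α] [DecidableEq α]
    (p : (Fintype.card α).Partition) (hp : ∀ m ∈ p.parts, 2 ≤ m) (v : ℂ) :
    (#{σ : Equiv.Perm α | σ.partition = p} : ℂ) * v ^ Multiset.card p.parts
      = (Fintype.card α).factorial * cycleWeight v p.parts := by
  have h : ∀ σ : Equiv.Perm α, σ.partition = p ↔ σ.cycleType = p.parts := by
    intro σ
    constructor
    · rintro rfl
      rw [← Equiv.Perm.filter_parts_partition_eq_cycleType, Multiset.filter_eq_self.2 hp]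
    · intro h
      have hs : #σ.support = Fintype.card α := by rw [← Equiv.Perm.sum_cycleType, h, p.parts_sum]
      refine Nat.Partition.ext ?_
      rw [Equiv.Perm.parts_partition, hs, h]
      simp
  have hc := Equiv.Perm.card_of_cycleType_mul_eq α p.parts
  rw [if_pos ⟨p.parts_sum.le, hp⟩, p.parts_sum, Nat.sub_self, Nat.factorial_zero, one_mul] at hc
  simp only [h]
  have hne : (p.parts.prod * ∏ i ∈ p.parts.toFinset, ((p.parts.count i).factorial : ℂ)) ≠ 0 := by
    have h0 : 0 < p.parts.prod := Multiset.prod_pos fun i hi => p.parts_pos hi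
    exact mul_ne_zero (Nat.cast_ne_zero.2 h0.ne')
      (Finset.prod_ne_zero_iff.2 fun i _ => Nat.cast_ne_zero.2 (Nat.factorial_ne_zero _))
  rw [← hc, cycleWeight, Nat.cast_mul, Nat.cast_mul, Nat.cast_prod, mul_assoc,
    mul_div_cancel₀ _ hne]

open Finset in
open scoped Classical in
theorem sum_pow_card_partition {α : Type*} [Fintype α] [DecidableEq α] {a : ℕ} (ha : 1 ≤ a)
    (v : ℂ) :
    ∑ σ : Equiv.Perm α with ∀ m ∈ σ.partition.parts, a < m,
      v ^ Multiset.card σ.partition.parts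
      = (Fintype.card α).factorial * partitionSum v a (Fintype.card α) := by
  rw [partitionSum, Finset.mul_sum, ← Finset.sum_fiberwise_of_maps_to
    (g := fun σ : Equiv.Perm α => σ.partition) (t := largePartitions a (Fintype.card α))]
  · refine Finset.sum_congr rfl fun p hp => ?_
    have hp' : ∀ m ∈ p.parts, a < m := (Finset.mem_filter.1 hp).2
    rw [← card_partition_eq p (fun m hm => by have := hp' m hm; omega) v, Finset.filter_filter,
      ← nsmul_eq_mul, ← Finset.sum_const]
    refine Finset.sum_congr (Finset.filter_congr fun σ _ => ?_) fun σ hσ => ?_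
    · constructor
      · exact fun h => h.2
      · rintro rfl
        exact ⟨hp', rfl⟩
    · rw [(Finset.mem_filter.1 hσ).2]
  · intro σ hσ
    exact Finset.mem_filter.2 ⟨Finset.mem_univ _, (Finset.mem_filter.1 hσ).2⟩

/-- Ensures that the range of k in the polynomial misses no a-derangement; for n = 0 it would miss
the empty permutation, which has no cycles. -/
theorem numCycles_mem_Icc {a n : ℕ} (hn : 1 ≤ n) {σ : Equiv.Perm (Fin n)}
    (hσ : IsADerangement a σ) : numCycles σ ∈ Finset.Icc 1 (n / (a + 1)) := by
  have hsum : σ.partition.parts.sum = n := by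
    rw [σ.partition.parts_sum, Fintype.card_fin]
  rw [Finset.mem_Icc, Nat.le_div_iff_mul_le (by omega)]
  constructor
  · refine Multiset.card_pos.2 fun h => ?_
    rw [h, Multiset.sum_zero] at hsum
    omega
  · have := Multiset.card_nsmul_le_sum (s := σ.partition.parts) (a := a + 1) hσ
    rwa [hsum, smul_eq_mul] at this

open scoped Classical in
theorem eval_aDerangementPoly {n : ℕ} (hn : 1 ≤ n) (a : ℕ) (v : ℂ) :
    (aDerangementPoly n a).eval v
      = ∑ σ : Equiv.Perm (Fin n) with IsADerangement a σ, v ^ numCycles σ := by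
  rw [aDerangementPoly, Polynomial.eval_finsetSum, ← Finset.sum_fiberwise_of_maps_to
    (g := numCycles) (t := Finset.Icc 1 (n / (a + 1)))
    (fun σ hσ => numCycles_mem_Icc hn (Finset.mem_filter.1 hσ).2)]
  refine Finset.sum_congr rfl fun k _ => ?_
  rw [Finset.sum_congr rfl fun σ hσ => by rw [(Finset.mem_filter.1 hσ).2], Finset.sum_const,
    Finset.filter_filter, numADerangementsCycles, Nat.card_eq_fintype_card, Fintype.card_subtype]
  simp

theorem eval_aDerangementPoly_eq_partitionSum {n a : ℕ} (hn : 1 ≤ n) (ha : 1 ≤ a) (v : ℂ) :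
    (aDerangementPoly n a).eval v = n.factorial * partitionSum v a n := by
  classical
  have h := sum_pow_card_partition (α := Fin n) ha v
  have hR : ∀ k, k = n → (k.factorial : ℂ) * partitionSum v a k
      = n.factorial * partitionSum v a n := fun k hk => by rw [hk]
  rw [eval_aDerangementPoly hn, ← hR _ (Fintype.card_fin n), ← h]
  exact Finset.sum_congr (Finset.filter_congr fun _ _ => Iff.rfl) fun _ _ => rfl

theorem proposition2 (v : ℂ) (hv : v ≠ 1) (hv' : ‖v‖ = 1) (a : ℕ) (ha : 1 ≤ a) :
    (∀ n : ℕ, 1 ≤ n → (aDerangementPoly n a).eval 1 = (numADerangements n a : ℂ)) ∧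
    (∀ n : ℕ, a < n → (aDerangementPoly n a).eval 1 ≠ 0) ∧
    Filter.Tendsto
      (fun n : ℕ => (aDerangementPoly n a).eval v / (aDerangementPoly n a).eval 1)
      Filter.atTop (nhds 0) := by
  classical
  obtain ⟨c, hc, hcn⟩ := exists_pos_le_of_average_recurrence ha
    (r := fun n => (partitionSum 1 a n).re) (by simp [partitionSum_zero]) (fun n => by
      have h := congrArg Complex.re (natCast_mul_partitionSum 1 a n)
      rwa [one_mul, Complex.re_sum, ← Complex.ofReal_natCast, Complex.re_ofReal_mul] at h)
  have hnorm : ∀ n, a < n → c ≤ ‖partitionSum 1 a n‖ := fun n hn =>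
    (hcn n hn).trans (Complex.re_le_norm _)
  refine ⟨fun n hn => ?_, fun n hn => ?_, ?_⟩
  · rw [eval_aDerangementPoly hn, numADerangements, Nat.card_eq_fintype_card,
      Fintype.card_subtype]
    simp
  · rw [eval_aDerangementPoly_eq_partitionSum (by omega) ha]
    refine mul_ne_zero (by exact_mod_cast n.factorial_ne_zero) ?_
    exact norm_pos_iff.1 (hc.trans_le (hnorm n hn))
  · have hlim := tendsto_zero_of_average_recurrence ha hv hv' (partitionSum_zero v a)
      (natCast_mul_partitionSum v a)
    refine squeeze_zero_norm' (a := fun n => ‖partitionSum v a n‖ / c) ?_ ?_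
    · filter_upwards [Filter.eventually_gt_atTop a] with n hn
      rw [eval_aDerangementPoly_eq_partitionSum (by omega) ha,
        eval_aDerangementPoly_eq_partitionSum (by omega) ha,
        mul_div_mul_left _ _ (by exact_mod_cast n.factorial_ne_zero), norm_div]
      exact div_le_div_of_nonneg_left (norm_nonneg _) hc (hnorm n hn)
    · simpa using hlim.norm.div_const c
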